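/- Let $d\ge 2$. For $x,y\in\mathbb{R}^d$ write $x\leqq y$ if $x_i\le y_i$ for all $i$; let $\mathbb{R}^d_+=\{x : x_i>0 \text{ for all } i\}$ and let $|\cdot|$ be the Euclidean norm. Let $\mathcal{A}$ be the set of curves $\gamma\in C^1([0,1];\mathbb{R}^d)$ such that, for every $t\in[0,1]$, $\gamma_i'(t)\ge 0$ for all $i$ and $\gamma'(t)\ne 0$. For $g:\mathbb{R}^d\to[0,\infty)$ bounded and Borel measurable set $$V_g(x)=\sup_{\gamma\in\mathcal{A},\ \gamma(1)\leqq x}\ \int_0^1 g(\gamma(t))^{1/d}\,\bigl(\gamma_1'(t)\cdots\gamma_d'(t)\bigr)^{1/d}\,dt ,\qquad x\in\mathbb{R}^d .$$ Let $\Omega\subset\mathbb{R}^d_+$ be open and bounded and satisfy (H2$^*$) for every $x\in\partial\Omega$ there are a cone $\mathcal{K}_x\subset\mathbb{R}^d$ (a set closed under multiplication by positive scalars) with nonempty interior and a neighborhood $N_x$ of $x$ such that $(y+\mathcal{K}_x)\cap\overline{\Omega}\cap N_x\subset\{y\}$ for every $y\in N_x\setminus\Omega$. Let $f:\mathbb{R}^d\to[0,\infty)$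 satisfy (H1) there is a continuous nondecreasing $m:[0,\infty)\to[0,\infty)$ with $m(0)=0$ such that $|f(x)-f(y)|\le m(|x-y|)$ for all $x,y\in\Omega$, and $f(x)=0$ for $x\notin\Omega$. Let $f_n:\mathbb{R}^d\to[0,\infty)$, $n=1,2,\dots$, each be bounded and Borel measurable with $\operatorname{supp}(f_n)\subset[0,1]^d$, and suppose that for every $x\in\mathbb{R}^d$ $$f_*(x)\ \le\ \lim_{j\to\infty}\inf\{f_n(y): n\ge j,\ |x-y|\le 1/j\}\quad\text{and}\quad \lim_{j\to\infty}\sup\{f_n(y): n\ge j,\ |x-y|\le 1/j\}\ \le\ f^*(x),$$ where the limits are taken in the extended reals and $f_*(x)=\lim_{r\downarrow0}\inf_{|x-y|\le r}f(y)$, $f^*(x)=\lim_{r\downarrow0}\sup_{|x-y|\le r}f(y)$ are the lower and upper semicontinuous envelopes of $f$. Then $U=V_f$ and all $v_n=V_{f_n}$ are finite everywhere, and $v_n\to U$ uniformly on $\mathbb{R}^d$ as $n\to\infty$. -/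

import Mathlib

open Set Filter Topology MeasureTheory

noncomputable section

namespace ParetoSort

/-- `ℝ^d` with the Euclidean norm. -/
abbrev Pt (d : ℕ) : Type := EuclideanSpace ℝ (Fin d)

/-- The componentwise partial order on `ℝ^d`. -/
def PLe {d : ℕ} (x y : Pt d) : Prop := ∀ i, x i ≤ y i

/-- The open positive orthant. -/
def posOrthant (d : ℕ) : Set (Pt d) := {x | ∀ i, 0 < x i}

/-- The closed unit cube `[0,1]^d`. -/
def unitCube (d : ℕ) : Set (Pt d) := {x | ∀ i, x i ∈ Icc (0 : ℝ) 1}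

/-- The derivative of a curve on `[0,1]`, one-sided at the two endpoints. -/
def velocity {d : ℕ} (γ : ℝ → Pt d) (t : ℝ) : Pt d := derivWithin γ (Icc 0 1) t

/-- The admissible curves: `γ ∈ C¹([0,1]; ℝ^d)` such that, for all `t ∈ [0,1]`, every component
of `γ'(t)` is nonnegative and `γ'(t) ≠ 0`. Only the values of `γ` on `[0,1]` matter. -/
def Admissible {d : ℕ} (γ : ℝ → Pt d) : Prop :=
  ContDiffOn ℝ 1 γ (Icc 0 1) ∧
    ∀ t ∈ Icc (0 : ℝ) 1, (∀ i, 0 ≤ velocity γ t i) ∧ velocity γ t ≠ 0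

/-- The energy `∫₀¹ f(γ(t))^{1/d} (γ₁'(t) ⋯ γ_d'(t))^{1/d} dt`. -/
def energy {d : ℕ} (f : Pt d → ℝ) (γ : ℝ → Pt d) : ℝ :=
  ∫ t in (0 : ℝ)..1, f (γ t) ^ (1 / (d : ℝ)) * (∏ i, velocity γ t i) ^ (1 / (d : ℝ))

/-- The energies of the admissible curves that end below `x`. -/
def energySet {d : ℕ} (f : Pt d → ℝ) (x : Pt d) : Set ℝ :=
  {e | ∃ γ : ℝ → Pt d, Admissible γ ∧ PLe (γ 1) x ∧ e = energy f γ}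

/-- The value function of the density `f`. -/
def valueFn {d : ℕ} (f : Pt d → ℝ) (x : Pt d) : ℝ := sSup (energySet f x)

/-- `f` is nonnegative, bounded and Borel measurable, with support in `[0,1]^d`. -/
structure IsCubeDensity {d : ℕ} (f : Pt d → ℝ) : Prop where
  nonneg : ∀ x, 0 ≤ f x
  bounded : ∃ C : ℝ, ∀ x, f x ≤ C
  measurable : Measurable f
  support_subset : tsupport f ⊆ unitCube d

/-- Hypothesis (H1): `f ≥ 0` has a modulus of continuity on `Ω` and vanishes off `Ω`. -/
structure HypH1 {d : ℕ} (Ω : Set (Pt d)) (f : Pt d → ℝ) : Prop where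
  nonneg : ∀ x, 0 ≤ f x
  modulus : ∃ m : NNReal → NNReal, Continuous m ∧ Monotone m ∧ m 0 = 0 ∧
    ∀ x ∈ Ω, ∀ y ∈ Ω, |f x - f y| ≤ m (nndist x y)
  zero_off : ∀ x, x ∉ Ω → f x = 0

/-- A (not necessarily convex) cone: closed under multiplication by positive scalars. -/
def IsCone {d : ℕ} (K : Set (Pt d)) : Prop := ∀ c : ℝ, 0 < c → ∀ v ∈ K, c • v ∈ K

/-- Hypothesis (H2*): `Ω` is an open bounded subset of the positive orthant that satisfies the
exterior cone condition at each of its boundary points. -/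
structure HypH2Star {d : ℕ} (Ω : Set (Pt d)) : Prop where
  isOpen : IsOpen Ω
  isBounded : Bornology.IsBounded Ω
  subset_orthant : Ω ⊆ posOrthant d
  cone : ∀ x ∈ frontier Ω, ∃ K : Set (Pt d), IsCone K ∧ (interior K).Nonempty ∧
    ∃ V ∈ 𝓝 x, ∀ y ∈ V \ Ω, ((fun v => y + v) '' K) ∩ closure Ω ∩ V ⊆ {y}

/-- The upper semicontinuous envelope
`f^*(x) = lim_{r ↓ 0} sup {f(y) : |x - y| ≤ r}`; the limit is an infimum. -/
def upperEnvelope {d : ℕ} (f : Pt d → ℝ) (x : Pt d) : EReal :=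
  ⨅ (r : ℝ) (_ : 0 < r), ⨆ (y : Pt d) (_ : dist x y ≤ r), (f y : EReal)

/-- The lower semicontinuous envelope
`f_*(x) = lim_{r ↓ 0} inf {f(y) : |x - y| ≤ r}`; the limit is a supremum. -/
def lowerEnvelope {d : ℕ} (f : Pt d → ℝ) (x : Pt d) : EReal :=
  ⨆ (r : ℝ) (_ : 0 < r), ⨅ (y : Pt d) (_ : dist x y ≤ r), (f y : EReal)

/-- The upper half-relaxed limit
`lim_{j → ∞} sup {f_n(y) : n ≥ j, |x - y| ≤ 1/j}`; the limit over `j ≥ 1` is an infimum. -/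
def upperRelaxedLimit {d : ℕ} (f : ℕ → Pt d → ℝ) (x : Pt d) : EReal :=
  ⨅ (j : ℕ) (_ : 1 ≤ j), ⨆ (n : ℕ) (_ : j ≤ n) (y : Pt d) (_ : dist x y ≤ 1 / (j : ℝ)),
    (f n y : EReal)

/-- The lower half-relaxed limit
`lim_{j → ∞} inf {f_n(y) : n ≥ j, |x - y| ≤ 1/j}`; the limit over `j ≥ 1` is a supremum. -/
def lowerRelaxedLimit {d : ℕ} (f : ℕ → Pt d → ℝ) (x : Pt d) : EReal :=
  ⨆ (j : ℕ) (_ : 1 ≤ j), ⨅ (n : ℕ) (_ : j ≤ n) (y : Pt d) (_ : dist x y ≤ 1 / (j : ℝ)),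
    (f n y : EReal)

end ParetoSort

end

/-! By (H1) and openness of `Ω`, `f` is lower semicontinuous, being continuous on `Ω` and zero, its
minimum, elsewhere. The lower envelope inequality thus gives `liminf fn ≥ f` pointwise, which also
forces `f` to vanish off the cube. Weighted AM-GM shows that a path in the cube with a small
increment in one coordinate has small energy, so `valueFn f` is uniformly continuous
(`exists_valueFn_le_add`). Paths can be concatenated, which gives the dynamic programming inequality
`valueFn_add_pathEnergy_le`.

Lower bound: Fatou along one nearly optimal curve gives `liminf valueFn (fn n) x ≥ valueFn f x`.
Monotonicity of `valueFn (fn n)`, uniform continuity of `valueFn f` and compactness of the cube make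
this uniform.

Upper bound: `f` may jump at `∂Ω`, so `fn` need not be almost below `f`. By the cone condition,
however, near each point some small translation pushes `closure Ω` into `Ω`, so that locally `fn n y
≤ f (y - δ • v) + η` for large `n` (`exists_translate_bound`). Since `v` depends on the point, a
path is cut into a bounded number of pieces, each inside one neighborhood of a finite cover. Each
piece is translated and compared with `valueFn f` by dynamic programming; uniform continuity pays
for the translation, and the errors add up to at most `κ`. -/

namespace ParetoSort

/-! ### Monotone paths, AM-GM estimates, and the part of a path in the cube. -/

variable {d : ℕ}

/-- A globally defined `C¹` curve `Γ` with componentwise nonnegative velocity `P`. -/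
structure MonoPath (Γ P : ℝ → Pt d) : Prop where
  hasDeriv : ∀ t, HasDerivAt Γ (P t) t
  cont : Continuous P
  nonneg : ∀ t i, 0 ≤ P t i

/-- The geometric mean of the components of the velocity. -/
noncomputable def weight (P : ℝ → Pt d) (t : ℝ) : ℝ := (∏ i, P t i) ^ (1 / (d : ℝ))

/-- The energy of a `C¹` curve over the time interval from `a` to `b`. -/
noncomputable def pathEnergy (f : Pt d → ℝ) (Γ P : ℝ → Pt d) (a b : ℝ) : ℝ :=
  ∫ t in a..b, f (Γ t) ^ (1 / (d : ℝ)) * weight P t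

lemma continuous_coord {P : ℝ → Pt d} (h : Continuous P) (i : Fin d) :
    Continuous fun t => P t i := (EuclideanSpace.proj i : Pt d →L[ℝ] ℝ).continuous.comp h

lemma hasDerivAt_coord {Γ : ℝ → Pt d} {v : Pt d} {t : ℝ} (h : HasDerivAt Γ v t) (i : Fin d) :
    HasDerivAt (fun t => Γ t i) (v i) t :=
  (EuclideanSpace.proj i : Pt d →L[ℝ] ℝ).hasFDerivAt.comp_hasDerivAt t h

/-- AM-GM for the numbers `c i * a i`, whose product is that of the `a i`; the factor `1 / d` of the
mean is discarded. The freedom in `c` is what yields smallness later. -/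
lemma prod_rpow_le_sum (hd : d ≠ 0) (a c : Fin d → ℝ) (ha : ∀ i, 0 ≤ a i) (hc : ∀ i, 0 ≤ c i)
    (hprod : ∏ i, c i = 1) : (∏ i, a i) ^ (1 / (d : ℝ)) ≤ ∑ i, c i * a i := by
  have hd0 : (0 : ℝ) < d := by exact_mod_cast Nat.pos_of_ne_zero hd
  have hd1 : (1 : ℝ) ≤ d := by exact_mod_cast Nat.pos_of_ne_zero hd
  have h1 : (∏ i, a i) = ∏ i, (c i * a i) := by rw [Finset.prod_mul_distrib, hprod, one_mul]
  rw [h1, ← Real.finsetProd_rpow _ _ fun i _ => mul_nonneg (hc i) (ha i)]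
  refine (Real.geom_mean_le_arith_mean_weighted Finset.univ (fun _ => 1 / (d : ℝ))
    (fun i => c i * a i) (fun _ _ => by positivity) ?_
    fun i _ => mul_nonneg (hc i) (ha i)).trans ?_
  · simp [hd0.ne']
  · refine Finset.sum_le_sum fun i _ => ?_
    refine mul_le_of_le_one_left (mul_nonneg (hc i) (ha i)) ?_
    rw [div_le_one hd0]; exact hd1

namespace MonoPath

variable {Γ P : ℝ → Pt d}

lemma continuous (h : MonoPath Γ P) : Continuous Γ :=
  continuous_iff_continuousAt.2 fun t => (h.hasDeriv t).continuousAt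

lemma mono (h : MonoPath Γ P) (i : Fin d) : Monotone fun t => Γ t i :=
  monotone_of_hasDerivAt_nonneg (fun t => hasDerivAt_coord (h.hasDeriv t) i) fun t => h.nonneg t i

lemma weight_nonneg (h : MonoPath Γ P) (t : ℝ) : 0 ≤ weight P t :=
  Real.rpow_nonneg (Finset.prod_nonneg fun i _ => h.nonneg t i) _

lemma continuous_weight (h : MonoPath Γ P) : Continuous (weight P) :=
  (continuous_finsetProd _ fun i _ => continuous_coord h.cont i).rpow_const
    fun _ => Or.inr (by positivity)

lemma integral_coord (h : MonoPath Γ P) (a b : ℝ) (i : Fin d) :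
    ∫ t in a..b, P t i = Γ b i - Γ a i :=
  intervalIntegral.integral_eq_sub_of_hasDerivAt (fun t _ => hasDerivAt_coord (h.hasDeriv t) i)
    ((continuous_coord h.cont i).intervalIntegrable _ _)

lemma integral_weight_le (h : MonoPath Γ P) (hd : d ≠ 0) {a b : ℝ} (hab : a ≤ b) (c : Fin d → ℝ)
    (hc : ∀ i, 0 ≤ c i) (hprod : ∏ i, c i = 1) :
    ∫ t in a..b, weight P t ≤ ∑ i, c i * (Γ b i - Γ a i) := by
  have hcont : ∀ i, Continuous fun t => c i * P t i := fun i =>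
    continuous_const.mul (continuous_coord h.cont i)
  calc ∫ t in a..b, weight P t ≤ ∫ t in a..b, ∑ i, c i * P t i :=
        intervalIntegral.integral_mono hab (h.continuous_weight.intervalIntegrable _ _)
          ((continuous_finsetSum _ fun i _ => hcont i).intervalIntegrable _ _)
          fun t => prod_rpow_le_sum hd _ c (h.nonneg t) hc hprod
    _ = ∑ i, c i * (Γ b i - Γ a i) := by
        rw [intervalIntegral.integral_finsetSum fun i _ => (hcont i).intervalIntegrable _ _]
        simp [h.integral_coord]

lemma integral_weight_le_sum (h : MonoPath Γ P) (hd : d ≠ 0) {a b : ℝ} (hab : a ≤ b) :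
    ∫ t in a..b, weight P t ≤ ∑ i, (Γ b i - Γ a i) := by
  simpa using h.integral_weight_le hd hab (fun _ => 1) (fun _ => zero_le_one) (by simp)

end MonoPath

/-- The short coordinate gets the large AM-GM coefficient `μ ^ (1 - d)` and all others get `μ`: the
long increments then cost at most `d * μ * L ≤ η / 2`, and `h` is chosen so that the short one costs
at most `η / 2`. -/
lemma exists_integral_weight_le (hd : d ≠ 0) (L η : ℝ) (hL : 0 ≤ L) (hη : 0 < η) :
    ∃ h > 0, ∀ Γ P : ℝ → Pt d, MonoPath Γ P → ∀ a b, a ≤ b → (∀ i, Γ b i - Γ a i ≤ L) →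
      (∃ i, Γ b i - Γ a i ≤ h) → ∫ t in a..b, weight P t ≤ η := by
  set μ : ℝ := η / (2 * (d * L + 1)) with hμ
  have hμ0 : 0 < μ := by positivity
  refine ⟨μ ^ (d - 1) * (η / 2), by positivity, ?_⟩
  rintro Γ P h a b hab hinc ⟨i, hi⟩
  have hn : ∀ j, 0 ≤ Γ b j - Γ a j := fun j => sub_nonneg.2 (h.mono j hab)
  refine (h.integral_weight_le hd hab (Function.update (fun _ => μ) i (μ ^ (d - 1))⁻¹)
    ?_ ?_).trans ?_
  · intro j
    by_cases hj : j = i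
    · subst hj; simp; positivity
    · simp [hj, hμ0.le]
  · rw [Finset.prod_update_of_mem (Finset.mem_univ i)]
    simp [Finset.card_sdiff, hμ0.ne']
  · have h1 : ∀ j, Function.update (fun _ => μ) i (μ ^ (d - 1))⁻¹ j * (Γ b j - Γ a j)
        ≤ (if j = i then η / 2 else 0) + μ * L := by
      intro j
      by_cases hj : j = i
      · subst hj
        simp only [Function.update_self, if_true]
        have : (μ ^ (d - 1))⁻¹ * (Γ b j - Γ a j) ≤ η / 2 := by
          rw [inv_mul_le_iff₀ (by positivity)]; exact hi
        have : 0 ≤ μ * L := by positivity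
        linarith
      · simp only [Function.update_of_ne hj, if_neg hj, zero_add]
        exact mul_le_mul_of_nonneg_left (hinc j) hμ0.le
    refine (Finset.sum_le_sum fun j _ => h1 j).trans ?_
    rw [Finset.sum_add_distrib]
    simp only [Finset.sum_ite_eq', Finset.mem_univ, if_true, Finset.sum_const, Finset.card_univ,
      Fintype.card_fin, nsmul_eq_mul]
    have : d * (μ * L) ≤ η / 2 := by
      have h2 : μ * (d * L + 1) = η / 2 := by rw [hμ]; field_simp
      nlinarith
    linarith

/-- A bounded nonnegative Borel function. -/
structure IsBddDensity (g : Pt d → ℝ) (C : ℝ) : Prop where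
  nonneg : ∀ x, 0 ≤ g x
  le : ∀ x, g x ≤ C
  measurable : Measurable g

namespace IsBddDensity

variable {g g' : Pt d → ℝ} {C C' : ℝ} {Γ P : ℝ → Pt d}

lemma rpow_le (hg : IsBddDensity g C) (x : Pt d) :
    g x ^ (1 / (d : ℝ)) ≤ C ^ (1 / (d : ℝ)) :=
  Real.rpow_le_rpow (hg.nonneg x) (hg.le x) (by positivity)

lemma rpow_nonneg (hg : IsBddDensity g C) (x : Pt d) : 0 ≤ g x ^ (1 / (d : ℝ)) :=
  Real.rpow_nonneg (hg.nonneg x) _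

lemma measurable_comp (hg : IsBddDensity g C) (h : MonoPath Γ P) :
    Measurable fun t => g (Γ t) ^ (1 / (d : ℝ)) :=
  (hg.measurable.comp h.continuous.measurable).pow_const _

lemma intervalIntegrable (hg : IsBddDensity g C) (h : MonoPath Γ P) (a b : ℝ) :
    IntervalIntegrable (fun t => g (Γ t) ^ (1 / (d : ℝ)) * weight P t) volume a b := by
  have key := h.continuous_weight.intervalIntegrable (μ := volume) a b
  rw [intervalIntegrable_iff] at key ⊢
  refine key.bdd_mul (c := C ^ (1 / (d : ℝ))) (hg.measurable_comp h).aestronglyMeasurable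
    (Eventually.of_forall fun t => ?_)
  rw [Real.norm_of_nonneg (hg.rpow_nonneg _)]
  exact hg.rpow_le _

lemma pathEnergy_nonneg (hg : IsBddDensity g C) (h : MonoPath Γ P) {a b : ℝ} (hab : a ≤ b) :
    0 ≤ pathEnergy g Γ P a b :=
  intervalIntegral.integral_nonneg hab fun t _ => mul_nonneg (hg.rpow_nonneg _) (h.weight_nonneg t)

lemma pathEnergy_add (hg : IsBddDensity g C) (h : MonoPath Γ P) (a b c : ℝ) :
    pathEnergy g Γ P a b + pathEnergy g Γ P b c = pathEnergy g Γ P a c :=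
  intervalIntegral.integral_add_adjacent_intervals (hg.intervalIntegrable h a b)
    (hg.intervalIntegrable h b c)

lemma pathEnergy_le (hg : IsBddDensity g C) (h : MonoPath Γ P) {a b : ℝ} (hab : a ≤ b) :
    pathEnergy g Γ P a b ≤ C ^ (1 / (d : ℝ)) * ∫ t in a..b, weight P t := by
  rw [← intervalIntegral.integral_const_mul]
  exact intervalIntegral.integral_mono hab (hg.intervalIntegrable h a b)
    ((continuous_const.mul h.continuous_weight).intervalIntegrable _ _)
    fun t => mul_le_mul_of_nonneg_right (hg.rpow_le _) (h.weight_nonneg t)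

end IsBddDensity

lemma IsCubeDensity.exists_isBddDensity {g : Pt d → ℝ} (hg : IsCubeDensity g) :
    ∃ C, 0 ≤ C ∧ IsBddDensity g C :=
  let ⟨C, hC⟩ := hg.bounded
  ⟨C, (hg.nonneg 0).trans (hC 0), hg.nonneg, hC, hg.measurable⟩

lemma IsCubeDensity.eq_zero {g : Pt d → ℝ} (hg : IsCubeDensity g) {x : Pt d}
    (hx : x ∉ unitCube d) : g x = 0 :=
  image_eq_zero_of_notMem_tsupport fun h => hx (hg.support_subset h)

lemma isClosed_unitCube : IsClosed (unitCube d) := by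
  have : unitCube d = ⋂ i, (fun x : Pt d => x i) ⁻¹' Icc 0 1 := by
    ext x; simp [unitCube]
  rw [this]
  exact isClosed_iInter fun i =>
    isClosed_Icc.preimage (EuclideanSpace.proj i : Pt d →L[ℝ] ℝ).continuous

lemma isCompact_unitCube : IsCompact (unitCube d) := by
  have h : IsCompact (univ.pi fun _ : Fin d => Icc (0 : ℝ) 1) :=
    isCompact_univ_pi fun _ => isCompact_Icc
  have h2 := h.image (PiLp.continuous_toLp 2 fun _ : Fin d => ℝ)
  convert h2 using 1
  ext x
  constructor
  · exact fun hx => ⟨x.ofLp, fun i _ => hx i, rfl⟩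
  · rintro ⟨y, hy, rfl⟩ i
    exact hy i trivial

/-- A curve sees a density on the unit cube only between its first and last visit to the cube. -/
lemma exists_restrict_unitCube {Γ P : ℝ → Pt d} (h : MonoPath Γ P) {a b : ℝ} (hab : a ≤ b) :
    (∀ g : Pt d → ℝ, 2 ≤ d → IsCubeDensity g → pathEnergy g Γ P a b = 0) ∨
    ∃ a' b', a ≤ a' ∧ a' ≤ b' ∧ b' ≤ b ∧ Γ a' ∈ unitCube d ∧ Γ b' ∈ unitCube d ∧
      ∀ g : Pt d → ℝ, 2 ≤ d → IsCubeDensity g → pathEnergy g Γ P a b = pathEnergy g Γ P a' b' := by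
  -- Only the open interval has to avoid the cube, since the first and last visits themselves lie in
  -- it.
  have hzero : ∀ g : Pt d → ℝ, 2 ≤ d → IsCubeDensity g → ∀ s t, s ≤ t →
      (∀ r ∈ Ioo s t, Γ r ∉ unitCube d) → pathEnergy g Γ P s t = 0 := by
    intro g hd hg s t hst hr
    have hd' : (1 / (d : ℝ)) ≠ 0 := by
      have : (0 : ℝ) < d := by exact_mod_cast (by omega : 0 < d)
      positivity
    rw [pathEnergy, intervalIntegral.integral_of_le hst, integral_Ioc_eq_integral_Ioo]
    refine setIntegral_eq_zero_of_forall_eq_zero fun r hrm => ?_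
    rw [hg.eq_zero (hr r hrm), Real.zero_rpow hd', zero_mul]
  set T : Set ℝ := Icc a b ∩ Γ ⁻¹' unitCube d with hT
  have hTc : IsCompact T := isCompact_Icc.inter_right (isClosed_unitCube.preimage h.continuous)
  rcases T.eq_empty_or_nonempty with he | hne
  · left
    intro g hd hg
    refine hzero g hd hg a b hab fun r hr hmem => ?_
    have : r ∈ T := ⟨Ioo_subset_Icc_self hr, hmem⟩
    simp [he] at this
  · right
    obtain ⟨a', ha', hamin⟩ := hTc.exists_isLeast hne
    obtain ⟨b', hb', hbmax⟩ := hTc.exists_isGreatest hne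
    refine ⟨a', b', ha'.1.1, hamin hb', hb'.1.2, ha'.2, hb'.2, fun g hd hg => ?_⟩
    obtain ⟨C, -, hC⟩ := hg.exists_isBddDensity
    rw [← hC.pathEnergy_add h a a' b, ← hC.pathEnergy_add h a' b' b,
      hzero g hd hg a a' ha'.1.1, hzero g hd hg b' b hb'.1.2]
    · ring
    · intro r hr hmem
      exact absurd (hbmax ⟨⟨hb'.1.1.trans hr.1.le, hr.2.le⟩, hmem⟩) (not_le.2 hr.1)
    · intro r hr hmem
      exact absurd (hamin ⟨⟨hr.1.le, hr.2.le.trans ha'.1.2⟩, hmem⟩) (not_le.2 hr.2)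

end ParetoSort

/-! ### Admissible curves as paths, reparametrization, a Fatou lemma, bounds on value functions. -/

namespace ParetoSort

variable {d : ℕ}

/-- The velocity is extended by its endpoint values beyond `[0,1]` and integrated, which removes
one-sided derivatives from all later arguments. -/
lemma Admissible.exists_monoPath {γ : ℝ → Pt d} (hγ : Admissible γ) :
    ∃ Γ P : ℝ → Pt d, MonoPath Γ P ∧ Γ 1 = γ 1 ∧
      ∀ g : Pt d → ℝ, energy g γ = pathEnergy g Γ P 0 1 := by
  obtain ⟨hC, hv⟩ := hγ
  have hcv : ContinuousOn (velocity γ) (Icc 0 1) :=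
    hC.continuousOn_derivWithin uniqueDiffOn_Icc_zero_one le_rfl
  set P : ℝ → Pt d := fun t => velocity γ (projIcc 0 1 zero_le_one t) with hP
  have hPc : Continuous P := hcv.comp_continuous
    (continuous_subtype_val.comp continuous_projIcc) fun t => (projIcc 0 1 zero_le_one t).2
  have hPe : ∀ t ∈ Icc (0 : ℝ) 1, P t = velocity γ t := fun t ht => by
    simp only [hP, projIcc_of_mem zero_le_one ht]
  set Γ : ℝ → Pt d := fun t => γ 0 + ∫ s in (0 : ℝ)..t, P s with hΓ
  have hΓd : ∀ t, HasDerivAt Γ (P t) t := fun t =>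
    (intervalIntegral.integral_hasDerivAt_right (hPc.intervalIntegrable _ _)
      (hPc.stronglyMeasurableAtFilter _ _) hPc.continuousAt).const_add _
  have hΓe : ∀ t ∈ Icc (0 : ℝ) 1, Γ t = γ t := by
    intro t ht
    have hd : DifferentiableOn ℝ γ (Icc 0 1) := hC.differentiableOn one_ne_zero
    have : ∫ s in (0 : ℝ)..t, P s = γ t - γ 0 := by
      refine intervalIntegral.integral_eq_sub_of_hasDerivAt_of_le ht.1
        (hC.continuousOn.mono (Icc_subset_Icc_right ht.2)) (fun s hs => ?_)
        (hPc.intervalIntegrable _ _)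
      have hs' : s ∈ Ioo (0 : ℝ) 1 := ⟨hs.1, hs.2.trans_le ht.2⟩
      rw [hPe s (Ioo_subset_Icc_self hs')]
      exact (hd s (Ioo_subset_Icc_self hs')).hasDerivWithinAt.hasDerivAt (Icc_mem_nhds hs'.1 hs'.2)
    simp [hΓ, this]
  refine ⟨Γ, P, ⟨hΓd, hPc, fun t => (hv _ (projIcc 0 1 zero_le_one t).2).1⟩,
    hΓe 1 (by simp), fun g => ?_⟩
  refine intervalIntegral.integral_congr fun t ht => ?_
  rw [uIcc_of_le zero_le_one] at ht
  simp only [weight, hΓe t ht, hPe t ht]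

lemma MonoPath.velocity_eq {Γ P : ℝ → Pt d} (h : MonoPath Γ P) {t : ℝ} (ht : t ∈ Icc (0 : ℝ) 1) :
    velocity Γ t = P t :=
  (h.hasDeriv t).hasDerivWithinAt.derivWithin (uniqueDiffOn_Icc_zero_one t ht)

lemma MonoPath.admissible {Γ P : ℝ → Pt d} (h : MonoPath Γ P) (hP : ∀ t, P t ≠ 0) :
    Admissible Γ := by
  refine ⟨ContDiff.contDiffOn ?_, fun t ht => ?_⟩
  · rw [contDiff_one_iff_deriv]
    refine ⟨fun t => (h.hasDeriv t).differentiableAt, ?_⟩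
    rw [funext fun t => (h.hasDeriv t).deriv]
    exact h.cont
  · rw [h.velocity_eq ht]
    exact ⟨h.nonneg t, hP t⟩

lemma MonoPath.energy_eq {Γ P : ℝ → Pt d} (h : MonoPath Γ P) (g : Pt d → ℝ) :
    energy g Γ = pathEnergy g Γ P 0 1 := by
  refine intervalIntegral.integral_congr fun t ht => ?_
  rw [uIcc_of_le zero_le_one] at ht
  simp only [weight, h.velocity_eq ht]

lemma MonoPath.comp {Γ P : ℝ → Pt d} (h : MonoPath Γ P) {φ φ' : ℝ → ℝ}
    (hφ : ∀ t, HasDerivAt φ (φ' t) t) (hc : Continuous φ') (hn : ∀ t, 0 ≤ φ' t) :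
    MonoPath (fun t => Γ (φ t)) (fun t => φ' t • P (φ t)) where
  hasDeriv t := (h.hasDeriv (φ t)).scomp t (hφ t)
  cont := hc.smul (h.cont.comp
    (continuous_iff_continuousAt.2 fun t => (hφ t).continuousAt))
  nonneg t i := mul_nonneg (hn t) (h.nonneg _ i)

lemma MonoPath.sub_const {Γ P : ℝ → Pt d} (h : MonoPath Γ P) (w : Pt d) :
    MonoPath (fun t => Γ t - w) P :=
  ⟨fun t => (h.hasDeriv t).sub_const w, h.cont, h.nonneg⟩

lemma MonoPath.add {Γ P Γ' P' : ℝ → Pt d} (h : MonoPath Γ P) (h' : MonoPath Γ' P') :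
    MonoPath (fun t => Γ t + Γ' t) (fun t => P t + P' t) :=
  ⟨fun t => (h.hasDeriv t).add (h'.hasDeriv t), h.cont.add h'.cont,
    fun t i => add_nonneg (h.nonneg t i) (h'.nonneg t i)⟩

lemma weight_smul (hd : d ≠ 0) {c : ℝ → ℝ} (hc : ∀ t, 0 ≤ c t) {P : ℝ → Pt d}
    (hP : ∀ t i, 0 ≤ P t i) (t : ℝ) : weight (fun t => c t • P t) t = c t * weight P t := by
  have : ∏ i, (c t • P t) i = c t ^ d * ∏ i, P t i := by
    simp [Finset.prod_mul_distrib]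
  rw [weight, this, Real.mul_rpow (pow_nonneg (hc t) d) (Finset.prod_nonneg fun i _ => hP t i),
    ← Real.rpow_natCast, ← Real.rpow_mul (hc t), mul_one_div_cancel (by exact_mod_cast hd),
    Real.rpow_one, weight]

/-- The weight is homogeneous of degree one in the velocity. The time change may be stationary,
which makes pauses possible. -/
lemma pathEnergy_comp (hd : d ≠ 0) {g : Pt d → ℝ} {Γ P : ℝ → Pt d} (h : MonoPath Γ P)
    {φ φ' : ℝ → ℝ} (hφ : ∀ t, HasDerivAt φ (φ' t) t) (hn : ∀ t, 0 ≤ φ' t) {a b : ℝ} (hab : a ≤ b) :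
    pathEnergy g (fun t => Γ (φ t)) (fun t => φ' t • P (φ t)) a b =
      pathEnergy g Γ P (φ a) (φ b) := by
  have hm : Monotone φ := monotone_of_hasDerivAt_nonneg hφ hn
  rw [pathEnergy, pathEnergy, intervalIntegral.integral_of_le hab,
    intervalIntegral.integral_of_le (hm hab), ← integral_Icc_eq_integral_Ioc,
    ← integral_Icc_eq_integral_Ioc, ← integral_Icc_deriv_smul_of_deriv_nonneg
      (f := φ) (f' := φ') (fun t _ => (hφ t).continuousAt.continuousWithinAt) (fun t _ => hφ t)
      (fun t _ => hn t) hab]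
  refine integral_congr_ae (Eventually.of_forall fun t => ?_)
  simp only [smul_eq_mul]
  rw [weight_smul hd hn (P := fun t => P (φ t)) (fun t i => h.nonneg _ i)]
  simp only [weight]
  ring

/-- A Fatou-type lemma for weighted interval integrals. -/
lemma eventually_lt_integral_mul {w G : ℝ → ℝ} {F : ℕ → ℝ → ℝ} {C : ℝ} {C' : ℕ → ℝ}
    (hw : Continuous w) (hw0 : ∀ t, 0 ≤ w t) (hG : Measurable G) (hG0 : ∀ t, 0 ≤ G t)
    (hGC : ∀ t, G t ≤ C) (hF : ∀ n, Measurable (F n)) (hF0 : ∀ n t, 0 ≤ F n t)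
    (hFC : ∀ n t, F n t ≤ C' n)
    (hlim : ∀ t, ∀ η > 0, ∀ᶠ n in atTop, G t - η ≤ F n t) {a b : ℝ} (hab : a ≤ b) {ε : ℝ}
    (hε : 0 < ε) :
    ∀ᶠ n in atTop, (∫ t in a..b, G t * w t) - ε < ∫ t in a..b, F n t * w t := by
  have hint : ∀ H : ℝ → ℝ, ∀ K, Measurable H → (∀ t, 0 ≤ H t) → (∀ t, H t ≤ K) →
      IntervalIntegrable (fun t => H t * w t) volume a b := by
    intro H K hH h0 hK
    have key := hw.intervalIntegrable (μ := volume) a b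
    rw [intervalIntegrable_iff] at key ⊢
    refine key.bdd_mul (c := K) hH.aestronglyMeasurable (Eventually.of_forall fun t => ?_)
    rw [Real.norm_of_nonneg (h0 t)]; exact hK t
  -- The truncation `min (F n t) (G t)` is dominated by `G` and converges to it, so no bound on `F
  -- n` uniform in `n` is needed.
  have htend : Tendsto (fun n => ∫ t in a..b, min (F n t) (G t) * w t) atTop
      (𝓝 (∫ t in a..b, G t * w t)) := by
    refine intervalIntegral.tendsto_integral_filter_of_dominated_convergence
      (fun t => G t * w t) (Eventually.of_forall fun n => ?_) (Eventually.of_forall fun n => ?_)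
      (hint G C hG hG0 hGC) (Eventually.of_forall fun t _ => ?_)
    · exact ((hF n).min hG).aestronglyMeasurable.mul hw.aestronglyMeasurable
    · refine Eventually.of_forall fun t _ => ?_
      rw [Real.norm_of_nonneg (mul_nonneg (le_min (hF0 n t) (hG0 t)) (hw0 t))]
      exact mul_le_mul_of_nonneg_right (min_le_right _ _) (hw0 t)
    · refine Tendsto.mul_const _ ?_
      rw [Metric.tendsto_nhds]
      intro η hη
      filter_upwards [hlim t (η / 2) (half_pos hη)] with n hn
      rw [Real.dist_eq, abs_lt]
      have h1 : min (F n t) (G t) ≤ G t := min_le_right _ _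
      have h2 : G t - η / 2 ≤ min (F n t) (G t) := le_min hn (by linarith)
      constructor <;> linarith
  filter_upwards [htend.eventually (lt_mem_nhds (sub_lt_self _ hε))] with n hn
  refine hn.trans_le (intervalIntegral.integral_mono hab
    (hint _ C ((hF n).min hG) (fun t => le_min (hF0 n t) (hG0 t))
      fun t => (min_le_right _ _).trans (hGC t))
    (hint _ _ (hF n) (hF0 n) (hFC n)) fun t => ?_)
  exact mul_le_mul_of_nonneg_right (min_le_left _ _) (hw0 t)

lemma eventually_sub_le_rpow {p x : ℝ} (hp : 0 < p) (hx : 0 ≤ x) {F : ℕ → ℝ}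
    (hF0 : ∀ n, 0 ≤ F n) (hF : ∀ η > 0, ∀ᶠ n in atTop, x - η ≤ F n) :
    ∀ η > 0, ∀ᶠ n in atTop, x ^ p - η ≤ F n ^ p := by
  intro η hη
  rcases hx.eq_or_lt with h0 | hpos
  · refine Eventually.of_forall fun n => ?_
    rw [← h0, Real.zero_rpow hp.ne']
    have := Real.rpow_nonneg (hF0 n) p
    linarith
  · have hc : ContinuousAt (fun y : ℝ => y ^ p) x :=
      Real.continuousAt_rpow_const _ _ (Or.inr hp.le)
    have := hc.eventually (lt_mem_nhds (sub_lt_self (x ^ p) hη))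
    obtain ⟨δ, hδ, hball⟩ := Metric.eventually_nhds_iff.1 this
    -- The cap at `x` keeps `x - δ'` nonnegative, as monotonicity of the power requires.
    set δ' := min (δ / 2) x
    have hδ' : 0 < δ' := lt_min (half_pos hδ) hpos
    have hd : dist (x - δ') x < δ := by
      rw [Real.dist_eq, sub_sub_cancel_left, abs_neg, abs_of_pos hδ']
      exact (min_le_left _ _).trans_lt (half_lt_self hδ)
    filter_upwards [hF δ' hδ'] with n hn
    exact (hball hd).le.trans
      (Real.rpow_le_rpow (sub_nonneg.2 (min_le_right _ _)) hn hp.le)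

lemma exists_bound_pathEnergy (hd : 2 ≤ d) {g : Pt d → ℝ} (hg : IsCubeDensity g) :
    ∃ B, 0 ≤ B ∧ ∀ Γ P : ℝ → Pt d, MonoPath Γ P → ∀ a b, a ≤ b → pathEnergy g Γ P a b ≤ B := by
  obtain ⟨C, hC0, hC⟩ := hg.exists_isBddDensity
  refine ⟨C ^ (1 / (d : ℝ)) * d, by positivity, fun Γ P h a b hab => ?_⟩
  rcases exists_restrict_unitCube h hab with h0 | ⟨a', b', -, hab', -, ha', hb', he⟩
  · rw [h0 g hd hg]; positivity
  · rw [he g hd hg]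
    refine (hC.pathEnergy_le h hab').trans
      (mul_le_mul_of_nonneg_left ?_ (by positivity))
    refine (h.integral_weight_le_sum (by omega) hab').trans ?_
    calc ∑ i, (Γ b' i - Γ a' i) ≤ ∑ _i : Fin d, (1 : ℝ) :=
          Finset.sum_le_sum fun i _ => by linarith [(hb' i).2, (ha' i).1]
      _ = d := by simp

lemma bddAbove_energySet (hd : 2 ≤ d) {g : Pt d → ℝ} (hg : IsCubeDensity g) (x : Pt d) :
    BddAbove (energySet g x) := by
  obtain ⟨B, -, hB⟩ := exists_bound_pathEnergy hd hg
  refine ⟨B, ?_⟩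
  rintro e ⟨γ, hγ, -, rfl⟩
  obtain ⟨Γ, P, h, -, he⟩ := hγ.exists_monoPath
  rw [he]
  exact hB Γ P h 0 1 zero_le_one

lemma valueFn_nonneg {g : Pt d → ℝ} (hg : IsCubeDensity g) (x : Pt d) : 0 ≤ valueFn g x := by
  refine Real.sSup_nonneg ?_
  rintro e ⟨γ, hγ, -, rfl⟩
  obtain ⟨Γ, P, h, -, he⟩ := hγ.exists_monoPath
  obtain ⟨C, -, hC⟩ := hg.exists_isBddDensity
  rw [he]
  exact hC.pathEnergy_nonneg h zero_le_one

/-- With `0 ≤ B` there is no need for `energySet g x` to be nonempty, as `sSup ∅ = 0`. -/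
lemma valueFn_le {g : Pt d → ℝ} {x : Pt d} {B : ℝ} (hB : 0 ≤ B)
    (h : ∀ Γ P : ℝ → Pt d, MonoPath Γ P → PLe (Γ 1) x → pathEnergy g Γ P 0 1 ≤ B) :
    valueFn g x ≤ B := by
  refine Real.sSup_le ?_ hB
  rintro e ⟨γ, hγ, hx, rfl⟩
  obtain ⟨Γ, P, hp, h1, he⟩ := hγ.exists_monoPath
  rw [he]
  exact h Γ P hp (h1 ▸ hx)

lemma PLe.trans {x y z : Pt d} (h : PLe x y) (h' : PLe y z) : PLe x z :=
  fun i => (h i).trans (h' i)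

lemma PLe.refl (x : Pt d) : PLe x x := fun _ => le_rfl

lemma valueFn_mono (hd : 2 ≤ d) {g : Pt d → ℝ} (hg : IsCubeDensity g) {x y : Pt d}
    (hxy : PLe x y) : valueFn g x ≤ valueFn g y := by
  refine Real.sSup_le ?_ (valueFn_nonneg hg y)
  rintro e ⟨γ, hγ, hx, rfl⟩
  exact le_csSup (bddAbove_energySet hd hg y) ⟨γ, hγ, hx.trans hxy, rfl⟩

end ParetoSort

/-! ### Dynamic programming and uniform continuity of the value function. -/

namespace ParetoSort

variable {d : ℕ}

/-- The vector with all components equal to one. -/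
def onesVec (d : ℕ) : Pt d := WithLp.toLp 2 fun _ => 1

@[simp] lemma onesVec_apply (i : Fin d) : onesVec d i = 1 := rfl

lemma monoPath_line (u q : Pt d) (hu : ∀ i, 0 ≤ u i) :
    MonoPath (fun t => q + t • u) (fun _ => u) :=
  ⟨fun t => by simpa using ((hasDerivAt_id t).smul_const u).const_add q, continuous_const,
    fun _ i => hu i⟩

/-- A path may stop and so fail to be admissible. A small multiple of the diagonal added to its
velocity repairs this; lower semicontinuity and Fatou recover the energy in the limit. -/
lemma pathEnergy_unit_le_valueFn (hd : 2 ≤ d) {f : Pt d → ℝ} (hf : IsCubeDensity f)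
    (hlsc : LowerSemicontinuous f) {Γ P : ℝ → Pt d} (h : MonoPath Γ P) :
    pathEnergy f Γ P 0 1 ≤ valueFn f (Γ 1) := by
  obtain ⟨C, hC0, hC⟩ := hf.exists_isBddDensity
  have hp : (0 : ℝ) < 1 / d := by
    have : (0 : ℝ) < d := by exact_mod_cast (by omega : 0 < d)
    positivity
  set e : ℕ → ℝ := fun n => 1 / ((n : ℝ) + 1) with he
  have he0 : ∀ n, 0 < e n := fun n => by positivity
  -- The correction is `(t - 1) * e n` along the diagonal, so the end point at `t = 1` is unchanged.
  set Γn : ℕ → ℝ → Pt d := fun n t => Γ t + (-(e n • onesVec d) + t • (e n • onesVec d)) with hΓn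
  set Pn : ℕ → ℝ → Pt d := fun n t => P t + e n • onesVec d with hPn
  have hn : ∀ n, MonoPath (Γn n) (Pn n) := fun n =>
    h.add (monoPath_line _ _ fun i => by simpa using (he0 n).le)
  have hpos : ∀ n t i, P t i ≤ Pn n t i := fun n t i => by
    simp only [hPn, PiLp.add_apply, PiLp.smul_apply, onesVec_apply, smul_eq_mul, mul_one]
    linarith [he0 n]
  have hadm : ∀ n, Admissible (Γn n) := fun n => (hn n).admissible fun t h0 => by
    have h1 : 0 < Pn n t ⟨0, by omega⟩ := by
      simp only [hPn, PiLp.add_apply, PiLp.smul_apply, onesVec_apply, smul_eq_mul, mul_one]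
      linarith [he0 n, h.nonneg t ⟨0, by omega⟩]
    simp [h0] at h1
  have hend : ∀ n, Γn n 1 = Γ 1 := fun n => by simp [hΓn]
  have hle : ∀ n, ∫ t in (0 : ℝ)..1, f (Γn n t) ^ (1 / (d : ℝ)) * weight P t ≤
      valueFn f (Γ 1) := by
    intro n
    have h1 : energy f (Γn n) ≤ valueFn f (Γ 1) :=
      le_csSup (bddAbove_energySet hd hf _) ⟨Γn n, hadm n, by rw [hend]; exact PLe.refl _, rfl⟩
    refine le_trans ?_ h1
    rw [(hn n).energy_eq]
    have hint : IntervalIntegrable (fun t => f (Γn n t) ^ (1 / (d : ℝ)) * weight P t)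
        volume 0 1 := by
      have key := h.continuous_weight.intervalIntegrable (μ := volume) 0 1
      rw [intervalIntegrable_iff] at key ⊢
      refine key.bdd_mul (c := C ^ (1 / (d : ℝ)))
        (hC.measurable_comp (hn n)).aestronglyMeasurable (Eventually.of_forall fun t => ?_)
      rw [Real.norm_of_nonneg (hC.rpow_nonneg _)]
      exact hC.rpow_le _
    refine intervalIntegral.integral_mono zero_le_one hint (hC.intervalIntegrable (hn n) 0 1)
      fun t => mul_le_mul_of_nonneg_left ?_ (hC.rpow_nonneg _)
    exact Real.rpow_le_rpow (Finset.prod_nonneg fun i _ => h.nonneg t i)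
      (Finset.prod_le_prod (fun i _ => h.nonneg t i) fun i _ => hpos n t i) hp.le
  have htend : ∀ t, Tendsto (fun n => Γn n t) atTop (𝓝 (Γ t)) := by
    intro t
    have h0 : Tendsto e atTop (𝓝 0) := tendsto_one_div_add_atTop_nhds_zero_nat
    have h1 : Tendsto (fun n => e n • onesVec d) atTop (𝓝 0) := by
      simpa using h0.smul_const (onesVec d)
    simpa using tendsto_const_nhds.add (h1.neg.add (h1.const_smul t))
  refine le_of_forall_pos_le_add fun ε hε => ?_
  have key := eventually_lt_integral_mul (G := fun t => f (Γ t) ^ (1 / (d : ℝ)))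
    (F := fun n t => f (Γn n t) ^ (1 / (d : ℝ))) h.continuous_weight h.weight_nonneg
    (hC.measurable_comp h) (fun t => hC.rpow_nonneg _) (fun t => hC.rpow_le _)
    (fun n => hC.measurable_comp (hn n)) (fun n t => hC.rpow_nonneg _) (fun n t => hC.rpow_le _)
    (fun t => eventually_sub_le_rpow hp (hC.nonneg _) (fun n => hC.nonneg _) fun η hη =>
      (((htend t).eventually (hlsc (Γ t) (f (Γ t) - η) (sub_lt_self _ hη))).mono
        fun n hn => hn.le)) zero_le_one hε
  obtain ⟨n, hn⟩ := key.exists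
  have := hle n
  rw [pathEnergy]
  linarith

lemma pathEnergy_le_valueFn (hd : 2 ≤ d) {f : Pt d → ℝ} (hf : IsCubeDensity f)
    (hlsc : LowerSemicontinuous f) {Γ P : ℝ → Pt d} (h : MonoPath Γ P) {a b : ℝ} (hab : a ≤ b) :
    pathEnergy f Γ P a b ≤ valueFn f (Γ b) := by
  have hφ : ∀ t, HasDerivAt (fun t : ℝ => a + t * (b - a)) (b - a) t := fun t => by
    simpa using ((hasDerivAt_id t).mul_const (b - a)).const_add a
  have hn : ∀ _t : ℝ, 0 ≤ b - a := fun _ => sub_nonneg.2 hab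
  have h1 := pathEnergy_comp (g := f) (by omega) h hφ hn zero_le_one
  have h2 := pathEnergy_unit_le_valueFn hd hf hlsc (h.comp hφ continuous_const hn)
  simp only [zero_mul, one_mul, add_zero, add_sub_cancel] at h1 h2
  rwa [h1] at h2

lemma pathEnergy_congr {g : Pt d → ℝ} {Γ P Γ' P' : ℝ → Pt d} {a b : ℝ} (hab : a ≤ b)
    (hΓ : ∀ t ∈ Icc a b, Γ t = Γ' t) (hP : ∀ t ∈ Icc a b, P t = P' t) :
    pathEnergy g Γ P a b = pathEnergy g Γ' P' a b := by
  refine intervalIntegral.integral_congr fun t ht => ?_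
  rw [uIcc_of_le hab] at ht
  simp only [weight, hΓ t ht, hP t ht]

lemma hasDerivAt_smoothTransition_shift (c t : ℝ) :
    HasDerivAt (fun t => Real.smoothTransition (t - c)) (deriv Real.smoothTransition (t - c)) t :=
  HasDerivAt.comp_sub_const t c
    ((Real.smoothTransition.contDiff (n := 1)).differentiable one_ne_zero _).hasDerivAt

lemma continuous_deriv_smoothTransition : Continuous (deriv Real.smoothTransition) :=
  (Real.smoothTransition.contDiff (n := 1)).continuous_deriv le_rfl

lemma deriv_smoothTransition_of_nonpos {t : ℝ} (ht : t ≤ 0) :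
    deriv Real.smoothTransition t = 0 :=
  IsLocalMin.deriv_eq_zero (Eventually.of_forall fun s => by
    rw [Real.smoothTransition.zero_of_nonpos ht]; exact Real.smoothTransition.nonneg s)

lemma deriv_smoothTransition_of_one_le {t : ℝ} (ht : 1 ≤ t) :
    deriv Real.smoothTransition t = 0 :=
  IsLocalMax.deriv_eq_zero (Eventually.of_forall fun s => by
    rw [Real.smoothTransition.one_of_one_le ht]; exact Real.smoothTransition.le_one s)

/-- The dynamic programming inequality: a curve may be continued by another one. -/
lemma valueFn_add_pathEnergy_le (hd : 2 ≤ d) {f : Pt d → ℝ} (hf : IsCubeDensity f)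
    (hlsc : LowerSemicontinuous f) {Γ P : ℝ → Pt d} (h : MonoPath Γ P) {a b : ℝ} (hab : a ≤ b) :
    valueFn f (Γ a) + pathEnergy f Γ P a b ≤ valueFn f (Γ b) := by
  obtain ⟨C, hC0, hC⟩ := hf.exists_isBddDensity
  rw [← le_sub_iff_add_le]
  refine valueFn_le (sub_nonneg.2 (pathEnergy_le_valueFn hd hf hlsc h hab)) fun Γ₀ P₀ h₀ hle => ?_
  rw [le_sub_iff_add_le]
  -- The concatenation runs over `[0,3]`: `Γ₀` up to `Γ₀ 1`, the segment from there to `Γ a`, then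
  -- `Γ` from `a` to `b`. Each phase starts and stops with velocity zero, so the sum of the three
  -- motions is `C¹`.
  set ψ := Real.smoothTransition with hψ
  have hψ' : ∀ t, 0 ≤ deriv ψ t := fun t => Real.smoothTransition.monotone.deriv_nonneg
  have hcψ : ∀ c, Continuous fun t => deriv ψ (t - c) := fun c =>
    continuous_deriv_smoothTransition.comp (continuous_id.sub continuous_const)
  have hφ : ∀ t, HasDerivAt (fun t => a + ψ (t - 2) * (b - a)) (deriv ψ (t - 2) * (b - a)) t :=
    fun t => ((hasDerivAt_smoothTransition_shift 2 t).mul_const (b - a)).const_add a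
  have hφ0 : ∀ t, 0 ≤ deriv ψ (t - 2) * (b - a) := fun t =>
    mul_nonneg (hψ' _) (sub_nonneg.2 hab)
  have p0 := h₀.comp (hasDerivAt_smoothTransition_shift 0) (hcψ 0) (fun t => hψ' _)
  have p1 := (monoPath_line (Γ a - Γ₀ 1) 0 fun i => by simpa using hle i).comp
    (hasDerivAt_smoothTransition_shift 1) (hcψ 1) (fun t => hψ' _)
  have p2 := (h.comp hφ ((hcψ 2).mul continuous_const) hφ0).sub_const (Γ a)
  have p := (p0.add p1).add p2
  have key := pathEnergy_le_valueFn hd hf hlsc p (show (0 : ℝ) ≤ 3 by norm_num)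
  have e3 : Γ₀ (Real.smoothTransition (3 - 0)) + (0 + Real.smoothTransition (3 - 1) • (Γ a - Γ₀ 1))
      + (Γ (a + ψ (3 - 2) * (b - a)) - Γ a) = Γ b := by
    rw [Real.smoothTransition.one_of_one_le (by norm_num : (1 : ℝ) ≤ 3 - 0),
      Real.smoothTransition.one_of_one_le (by norm_num : (1 : ℝ) ≤ 3 - 1), hψ,
      Real.smoothTransition.one_of_one_le (by norm_num : (1 : ℝ) ≤ 3 - 2)]
    simp
  simp only [e3] at key
  rw [← hC.pathEnergy_add p 0 1 3, ← hC.pathEnergy_add p 1 2 3] at key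
  -- The connecting segment only needs to contribute a nonnegative amount.
  have n1 := hC.pathEnergy_nonneg p (show (1 : ℝ) ≤ 2 by norm_num)
  have c0 := pathEnergy_comp (g := f) (by omega) h₀ (hasDerivAt_smoothTransition_shift 0)
    (fun t => hψ' _) zero_le_one
  have c2 := pathEnergy_comp (g := f) (by omega) h hφ hφ0 (show (2 : ℝ) ≤ 3 by norm_num)
  have v0 : ∀ t : ℝ, t ≤ 0 → ψ t = 0 := fun t ht => Real.smoothTransition.zero_of_nonpos ht
  have v1 : ∀ t : ℝ, 1 ≤ t → ψ t = 1 := fun t ht => Real.smoothTransition.one_of_one_le ht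
  have d0 : ∀ t : ℝ, t ≤ 0 → deriv ψ t = 0 := fun t ht => deriv_smoothTransition_of_nonpos ht
  have d1 : ∀ t : ℝ, 1 ≤ t → deriv ψ t = 0 := fun t ht => deriv_smoothTransition_of_one_le ht
  simp only [← hψ] at key c0 c2 n1
  rw [pathEnergy_congr (Γ' := fun t => Γ₀ (ψ (t - 0))) (P' := fun t => deriv ψ (t - 0) • P₀ (ψ (t - 0)))
      zero_le_one, c0] at key
  rotate_left
  · intro t ht
    simp [v0 (t - 1) (by linarith [ht.2]), v0 (t - 2) (by linarith [ht.2])]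
  · intro t ht
    simp [d0 (t - 1) (by linarith [ht.2]), d0 (t - 2) (by linarith [ht.2])]
  rw [pathEnergy_congr (a := 2) (b := 3) (Γ' := fun t => Γ (a + ψ (t - 2) * (b - a)))
      (P' := fun t => (deriv ψ (t - 2) * (b - a)) • P (a + ψ (t - 2) * (b - a)))
      (by norm_num), c2] at key
  rotate_left
  · intro t ht
    simp [v1 t (by linarith [ht.1]), v1 (t - 1) (by linarith [ht.1])]
  · intro t ht
    simp [d1 t (by linarith [ht.1]), d1 (t - 1) (by linarith [ht.1])]
  rw [v0 (0 - 0) (by norm_num), v1 (1 - 0) (by norm_num), v0 (2 - 2) (by norm_num),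
    v1 (3 - 2) (by norm_num)] at key
  simp only [zero_mul, one_mul, add_zero, add_sub_cancel] at key
  linarith

/-- The value function of a lower semicontinuous density is uniformly continuous. -/
lemma exists_valueFn_le_add (hd : 2 ≤ d) {f : Pt d → ℝ} (hf : IsCubeDensity f)
    (hlsc : LowerSemicontinuous f) {η : ℝ} (hη : 0 < η) :
    ∃ h > 0, ∀ x y : Pt d, (∀ i, x i ≤ y i + h) → valueFn f x ≤ valueFn f y + η := by
  obtain ⟨C, hC0, hC⟩ := hf.exists_isBddDensity
  have hCp : 0 ≤ C ^ (1 / (d : ℝ)) := by positivity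
  obtain ⟨h, hh, hbound⟩ := exists_integral_weight_le (d := d) (by omega) 1
    (η / (C ^ (1 / (d : ℝ)) + 1)) zero_le_one (by positivity)
  refine ⟨h, hh, fun x y hxy => valueFn_le (add_nonneg (valueFn_nonneg hf y) hη.le)
    fun Γ P hp hx => ?_⟩
  have hv := valueFn_nonneg hf y
  rcases exists_restrict_unitCube hp zero_le_one with h0 | ⟨a, b, -, hab, hb1, ha, hb, he⟩
  · rw [h0 f hd hf]; linarith
  rw [he f hd hf]
  -- Once the path has reached `y i` in some coordinate `i`, at most `h` remains there, because `Γ 1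
  -- i ≤ x i ≤ y i + h`.
  have hsmall : ∀ c, a ≤ c → c ≤ b → (∃ i, y i ≤ Γ c i) → pathEnergy f Γ P c b ≤ η := by
    rintro c hac hcb ⟨i, hi⟩
    refine (hC.pathEnergy_le hp hcb).trans ?_
    have h1 := hbound Γ P hp c b hcb
      (fun j => by linarith [(hb j).2, (ha j).1, hp.mono j hac])
      ⟨i, by linarith [hp.mono i hb1, hx i, hxy i]⟩
    calc C ^ (1 / (d : ℝ)) * ∫ t in c..b, weight P t
        ≤ C ^ (1 / (d : ℝ)) * (η / (C ^ (1 / (d : ℝ)) + 1)) := mul_le_mul_of_nonneg_left h1 hCp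
      _ ≤ η := by
          rw [mul_div_assoc', div_le_iff₀ (by positivity)]; nlinarith
  have hbelow : ∀ c, a ≤ c → PLe (Γ c) y → pathEnergy f Γ P a c ≤ valueFn f y := fun c hac hc =>
    (pathEnergy_le_valueFn hd hf hlsc hp hac).trans (valueFn_mono hd hf hc)
  have hne : (Finset.univ : Finset (Fin d)).Nonempty := ⟨⟨0, by omega⟩, Finset.mem_univ _⟩
  -- The largest excess over `y`: at a zero of `φ` the path is still below `y` and touches it in
  -- some coordinate, so both estimates apply.
  set φ : ℝ → ℝ := fun t => Finset.univ.sup' hne fun i => Γ t i - y i with hφ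
  have hφc : Continuous φ := Continuous.finset_sup'_apply hne fun i _ =>
    (continuous_coord hp.continuous i).sub continuous_const
  have hle : ∀ t, φ t ≤ 0 → PLe (Γ t) y := fun t ht i => by
    have := (Finset.le_sup' (fun i => Γ t i - y i) (Finset.mem_univ i)).trans ht
    linarith
  have hge : ∀ t, 0 ≤ φ t → ∃ i, y i ≤ Γ t i := fun t ht => by
    obtain ⟨i, -, hi⟩ := Finset.exists_mem_eq_sup' hne fun i => Γ t i - y i
    refine ⟨i, ?_⟩
    have : 0 ≤ Γ t i - y i := by rw [← hi]; exact ht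
    linarith
  rcases le_or_gt (φ b) 0 with hb0 | hb0
  · linarith [hbelow b hab (hle b hb0)]
  rcases le_or_gt 0 (φ a) with ha0 | ha0
  · linarith [hsmall a le_rfl hab (hge a ha0)]
  obtain ⟨c, hc, hc0⟩ := intermediate_value_Icc hab hφc.continuousOn ⟨ha0.le, hb0.le⟩
  rw [← hC.pathEnergy_add hp a c b]
  linarith [hbelow c hc.1 (hle c hc0.le), hsmall c hc.1 hc.2 (hge c hc0.ge)]

end ParetoSort

/-! ### Consequences of (H1), the envelope inequalities and the cone condition. -/

namespace ParetoSort

variable {d : ℕ} {Ω : Set (Pt d)} {f : Pt d → ℝ} {fn : ℕ → Pt d → ℝ}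

lemma HypH1.exists_modulus (hf : HypH1 Ω f) {η : ℝ} (hη : 0 < η) :
    ∃ ρ > 0, ∀ x ∈ Ω, ∀ y ∈ Ω, dist x y < ρ → |f x - f y| < η := by
  obtain ⟨m, hmc, -, hm0, hm⟩ := hf.modulus
  have h1 : ∀ᶠ s in 𝓝 (0 : NNReal), (m s : ℝ) < η := by
    have : Tendsto (fun s => (m s : ℝ)) (𝓝 0) (𝓝 0) := by
      have := (NNReal.continuous_coe.comp hmc).tendsto 0
      simpa [hm0, Function.comp_def] using this
    exact this.eventually (gt_mem_nhds hη)
  obtain ⟨ρ, hρ, hball⟩ := Metric.eventually_nhds_iff.1 h1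
  refine ⟨ρ, hρ, fun x hx y hy hxy => (hm x hx y hy).trans_lt (hball ?_)⟩
  rw [NNReal.dist_eq]
  simpa using hxy

lemma HypH1.lowerSemicontinuous (hf : HypH1 Ω f) (hΩ : IsOpen Ω) : LowerSemicontinuous f := by
  intro x c hc
  by_cases hx : x ∈ Ω
  · obtain ⟨ρ, hρ, h⟩ := hf.exists_modulus (sub_pos.2 hc)
    filter_upwards [hΩ.mem_nhds hx, Metric.ball_mem_nhds x hρ] with y hy hyx
    have := abs_lt.1 (h y hy x hx hyx)
    linarith [this.1]
  · rw [hf.zero_off x hx] at hc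
    exact Eventually.of_forall fun y => hc.trans_le (hf.nonneg y)

lemma HypH1.bounded (hf : HypH1 Ω f) (hΩ : Bornology.IsBounded Ω) : ∃ C, ∀ x, f x ≤ C := by
  obtain ⟨m, -, hmm, -, hm⟩ := hf.modulus
  rcases Ω.eq_empty_or_nonempty with he | ⟨x₀, hx₀⟩
  · exact ⟨0, fun x => (hf.zero_off x (by simp [he])).le⟩
  obtain ⟨D, hD⟩ := Metric.isBounded_iff_nndist.1 hΩ
  refine ⟨f x₀ + m D, fun x => ?_⟩
  have h0 := hf.nonneg x₀
  by_cases hx : x ∈ Ω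
  · have h1 := (abs_le.1 (hm x hx x₀ hx₀)).2
    have h2 : (m (nndist x x₀) : ℝ) ≤ m D := by exact_mod_cast hmm (hD hx hx₀)
    linarith
  · rw [hf.zero_off x hx]; positivity

lemma eventually_sub_le_of_lower (hlsc : LowerSemicontinuous f)
    (hlower : ∀ x, lowerEnvelope f x ≤ lowerRelaxedLimit fn x) (x : Pt d) {η : ℝ} (hη : 0 < η) :
    ∀ᶠ n in atTop, f x - η ≤ fn n x := by
  obtain ⟨r, hr, hball⟩ := Metric.eventually_nhds_iff.1
    (hlsc x (f x - η / 2) (sub_lt_self _ (half_pos hη)))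
  have h1 : ((f x - η / 2 : ℝ) : EReal) ≤ lowerEnvelope f x := by
    refine le_iSup₂_of_le (r / 2) (half_pos hr) (le_iInf₂ fun y hy => ?_)
    rw [EReal.coe_le_coe_iff]
    refine (hball ?_).le
    rw [dist_comm]
    exact hy.trans_lt (half_lt_self hr)
  have h2 : ((f x - η : ℝ) : EReal) < lowerRelaxedLimit fn x :=
    lt_of_lt_of_le (by rw [EReal.coe_lt_coe_iff]; linarith) (h1.trans (hlower x))
  simp only [lowerRelaxedLimit, lt_iSup_iff] at h2
  obtain ⟨j, hj, h3⟩ := h2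
  filter_upwards [eventually_ge_atTop j] with n hn
  have h4 := h3.le.trans (iInf₂_le n hn)
  have h5 := h4.trans (iInf₂_le x (by rw [dist_self]; positivity))
  rwa [EReal.coe_le_coe_iff] at h5

lemma exists_nhds_le_add_of_upper
    (hupper : ∀ x, upperRelaxedLimit fn x ≤ upperEnvelope f x) {y₀ : Pt d} {c r : ℝ} (hr : 0 < r)
    (hc : ∀ y, dist y₀ y ≤ r → f y ≤ c) {η : ℝ} (hη : 0 < η) :
    ∃ U ∈ 𝓝 y₀, ∀ᶠ n in atTop, ∀ y ∈ U, fn n y ≤ c + η := by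
  have h1 : upperEnvelope f y₀ ≤ (c : EReal) :=
    iInf₂_le_of_le r hr (iSup₂_le fun y hy => by rw [EReal.coe_le_coe_iff]; exact hc y hy)
  have h2 : upperRelaxedLimit fn y₀ < ((c + η : ℝ) : EReal) :=
    ((hupper y₀).trans h1).trans_lt (by rw [EReal.coe_lt_coe_iff]; linarith)
  simp only [upperRelaxedLimit, iInf_lt_iff] at h2
  obtain ⟨j, hj, h3⟩ := h2
  have hj0 : (0 : ℝ) < 1 / (j : ℝ) := by
    have : (0 : ℝ) < j := by exact_mod_cast hj
    positivity
  refine ⟨Metric.ball y₀ (1 / (j : ℝ)), Metric.ball_mem_nhds _ hj0, ?_⟩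
  filter_upwards [eventually_ge_atTop j] with n hn y hy
  have h4 : (fn n y : EReal) ≤ ⨆ (n : ℕ) (_ : j ≤ n) (y : Pt d) (_ : dist y₀ y ≤ 1 / (j : ℝ)),
      (fn n y : EReal) :=
    le_iSup₂_of_le n hn (le_iSup₂_of_le y (by rw [dist_comm]; exact (Metric.mem_ball.1 hy).le) le_rfl)
  have h5 := h4.trans h3.le
  rwa [EReal.coe_le_coe_iff] at h5

lemma HypH1.isCubeDensity (hf : HypH1 Ω f) (hΩ : HypH2Star Ω)
    (hfn : ∀ n, IsCubeDensity (fn n))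
    (hlower : ∀ x, lowerEnvelope f x ≤ lowerRelaxedLimit fn x) : IsCubeDensity f := by
  have hlsc := hf.lowerSemicontinuous hΩ.isOpen
  refine ⟨hf.nonneg, hf.bounded hΩ.isBounded, hlsc.measurable, ?_⟩
  refine closure_minimal (fun x hx => ?_) isClosed_unitCube
  by_contra hxc
  refine hx (le_antisymm (le_of_forall_pos_le_add fun η hη => ?_) (hf.nonneg x))
  -- Off the cube every `fn n` vanishes, so the lower envelope inequality leaves `f x ≤ η`.
  obtain ⟨n, hn⟩ := (eventually_sub_le_of_lower hlsc hlower x hη).exists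
  rw [(hfn n).eq_zero hxc] at hn
  linarith

/-- Near every point, some small translations move the closure of `Ω` into `Ω`. -/
lemma HypH2Star.exists_ball_subset (hd : d ≠ 0) (hΩ : HypH2Star Ω) (x : Pt d) :
    ∃ v : Pt d, ∃ r > 0, ∃ ρ > 0, ∃ δ₀ > 0, ∀ δ, 0 < δ → δ < δ₀ →
      ∀ y ∈ closure Ω, dist y x ≤ ρ → Metric.ball (y - δ • v) (δ * r) ⊆ Ω := by
  by_cases hx : x ∈ closure Ω
  swap
  · obtain ⟨ρ, hρ, hball⟩ := Metric.mem_nhds_iff.1 (isClosed_closure.isOpen_compl.mem_nhds hx)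
    refine ⟨0, 1, one_pos, ρ / 2, half_pos hρ, 1, one_pos, fun δ _ _ y hy hyx => ?_⟩
    exact absurd hy (hball (hyx.trans_lt (half_lt_self hρ)))
  by_cases hxΩ : x ∈ Ω
  · obtain ⟨ρ, hρ, hball⟩ := Metric.mem_nhds_iff.1 (hΩ.isOpen.mem_nhds hxΩ)
    refine ⟨0, 1, one_pos, ρ / 2, half_pos hρ, ρ / 2, half_pos hρ, fun δ _ hδ y _ hyx p hp => ?_⟩
    refine hball ?_
    simp only [smul_zero, sub_zero, mul_one, Metric.mem_ball] at hp ⊢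
    linarith [dist_triangle p y x]
  obtain ⟨K, hK, hKi, V, hV, hcone⟩ := hΩ.cone x ⟨hx, by rwa [hΩ.isOpen.interior_eq]⟩
  have : Nonempty (Fin d) := ⟨⟨0, Nat.pos_of_ne_zero hd⟩⟩
  obtain ⟨v, hvK, hv0⟩ := (dense_compl_singleton (0 : Pt d)).inter_open_nonempty _
    isOpen_interior hKi
  have hv : 0 < ‖v‖ := norm_pos_iff.2 hv0
  obtain ⟨r', hr', hball'⟩ := Metric.mem_nhds_iff.1 (mem_interior_iff_mem_nhds.1 hvK)
  -- The bound `r ≤ ‖v‖` keeps `y` itself out of the ball around `y - δ • v`; this excludes the apex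
  -- `y = p` at the end.
  set r := min r' ‖v‖ with hr
  have hr0 : 0 < r := lt_min hr' hv
  obtain ⟨ρ, hρ, hballV⟩ := Metric.mem_nhds_iff.1 hV
  refine ⟨v, r, hr0, ρ / 2, half_pos hρ, ρ / 2 / (‖v‖ + r), by positivity,
    fun δ hδ hδ' y hy hyx p hp => ?_⟩
  rw [lt_div_iff₀ (by positivity)] at hδ'
  rw [Metric.mem_ball, dist_eq_norm] at hp
  have hk : ‖(y - p) - δ • v‖ < δ * r := by
    rw [show (y - p) - δ • v = -(p - (y - δ • v)) by abel, norm_neg]; exact hp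
  have hyp : ‖y - p‖ < δ * (‖v‖ + r) := by
    calc ‖y - p‖ = ‖((y - p) - δ • v) + δ • v‖ := by rw [sub_add_cancel]
      _ ≤ ‖(y - p) - δ • v‖ + ‖δ • v‖ := norm_add_le _ _
      _ < δ * r + δ * ‖v‖ := by rw [norm_smul, Real.norm_of_nonneg hδ.le]; linarith
      _ = δ * (‖v‖ + r) := by ring
  -- For `p ∉ Ω` the cone with apex `p` meets `closure Ω` near `x` at most in `p`; but it contains
  -- `y`, since `δ⁻¹ • (y - p)` is within `r` of `v`.
  by_contra hpΩ
  have hpV : p ∈ V := hballV (by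
    rw [Metric.mem_ball]
    have := dist_triangle p y x
    rw [dist_comm p y, dist_eq_norm y p] at this
    linarith)
  have hyV : y ∈ V := hballV (by rw [Metric.mem_ball]; linarith)
  have hmem : δ⁻¹ • (y - p) ∈ K := by
    refine hball' ?_
    rw [Metric.mem_ball, dist_eq_norm]
    have : δ⁻¹ • (y - p) - v = δ⁻¹ • ((y - p) - δ • v) := by
      rw [smul_sub δ⁻¹ (y - p), smul_smul, inv_mul_cancel₀ hδ.ne', one_smul]
    rw [this, norm_smul, norm_inv, Real.norm_of_nonneg hδ.le, inv_mul_lt_iff₀ hδ]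
    exact hk.trans_le (mul_le_mul_of_nonneg_left (min_le_left _ _) hδ.le)
  have hyp0 : y = p := hcone p ⟨hpV, hpΩ⟩ ⟨⟨⟨y - p, by
    have := hK δ hδ _ hmem
    rwa [smul_smul, mul_inv_cancel₀ hδ.ne', one_smul] at this, by simp⟩, hy⟩, hyV⟩
  rw [hyp0, sub_self, zero_sub, norm_neg, norm_smul, Real.norm_of_nonneg hδ.le] at hk
  exact absurd (lt_of_mul_lt_mul_left hk hδ.le) (not_lt.2 (min_le_right _ _))

/-- Locally, `f_n` is eventually almost dominated by a small translate of `f`. -/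
lemma exists_translate_bound (hd : d ≠ 0) (hΩ : HypH2Star Ω) (hf : HypH1 Ω f)
    (hupper : ∀ x, upperRelaxedLimit fn x ≤ upperEnvelope f x) (x : Pt d) :
    ∃ v : Pt d, ∃ W ∈ 𝓝 x, ∀ η > 0, ∀ᶠ δ : ℝ in 𝓝[>] 0, ∀ᶠ n in atTop, ∀ y ∈ W,
      fn n y ≤ f (y - δ • v) + η := by
  obtain ⟨v, r, hr, ρ, hρ, δ₀, hδ₀, hball⟩ := hΩ.exists_ball_subset hd x
  refine ⟨v, Metric.closedBall x ρ, Metric.closedBall_mem_nhds x hρ, fun η hη => ?_⟩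
  obtain ⟨s, hs, hmod⟩ := hf.exists_modulus (show 0 < η / 3 by positivity)
  have hmin : 0 < min δ₀ (s / (‖v‖ + r)) := lt_min hδ₀ (by positivity)
  filter_upwards [Ioo_mem_nhdsGT hmin] with δ hδ
  have hδ0 : 0 < δ := hδ.1
  have hδs : δ * (‖v‖ + r) < s := by
    have := hδ.2.trans_le (min_le_right _ _)
    rwa [lt_div_iff₀ (by positivity)] at this
  refine (isCompact_closedBall x ρ).induction_on
    (p := fun S => ∀ᶠ n in atTop, ∀ y ∈ S, fn n y ≤ f (y - δ • v) + η) (by simp)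
    (fun S T hST h => h.mono fun n hn y hy => hn y (hST hy))
    (fun S T hS hT => by
      filter_upwards [hS, hT] with n h1 h2 y hy
      exact hy.elim (h1 y) (h2 y)) fun y₀ hy₀ => ?_
  -- For `y₀ ∈ closure Ω`, errors of `η / 3` arise from `f` near `y₀` against `f (y₀ - δ • v)`, from
  -- the relaxed limit, and from replacing `y₀` by `y` in the translate. Points off `Ω` do no harm,
  -- as `f` vanishes there.
  by_cases hcl : y₀ ∈ closure Ω
  · have hsub := hball δ hδ0 (hδ.2.trans_le (min_le_left _ _)) y₀ hcl hy₀
    have hy₀Ω : y₀ - δ • v ∈ Ω := hsub (Metric.mem_ball_self (by positivity))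
    have hδv : ‖δ • v‖ = δ * ‖v‖ := by rw [norm_smul, Real.norm_of_nonneg hδ0.le]
    obtain ⟨U, hU, hUn⟩ := exists_nhds_le_add_of_upper (f := f) (c := f (y₀ - δ • v) + η / 3)
      (r := δ * r) hupper (by positivity) (y₀ := y₀) (fun y hy => by
        by_cases hyΩ : y ∈ Ω
        · have h1 : dist y (y₀ - δ • v) < s := by
            have h2 := dist_triangle y y₀ (y₀ - δ • v)
            rw [dist_comm y y₀, dist_eq_norm y₀ (y₀ - δ • v), sub_sub_cancel, hδv] at h2
            linarith
          linarith [(abs_lt.1 (hmod y hyΩ _ hy₀Ω h1)).2]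
        · rw [hf.zero_off y hyΩ]
          linarith [hf.nonneg (y₀ - δ • v)]) (show 0 < η / 3 by positivity)
    refine ⟨U ∩ Metric.ball y₀ (δ * r), mem_nhdsWithin_of_mem_nhds
      (inter_mem hU (Metric.ball_mem_nhds _ (by positivity))), ?_⟩
    filter_upwards [hUn] with n hn y hy
    have h1 := hn y hy.1
    have hdist : dist (y - δ • v) (y₀ - δ • v) < δ * r := by
      rw [dist_sub_right]; exact hy.2
    have h2 := hmod (y₀ - δ • v) hy₀Ω (y - δ • v) (hsub hdist) (by
      rw [dist_comm]
      have : 0 ≤ δ * ‖v‖ := by positivity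
      linarith)
    linarith [(abs_lt.1 h2).2]
  · obtain ⟨t, ht, htΩ⟩ := Metric.mem_nhds_iff.1 (isClosed_closure.isOpen_compl.mem_nhds hcl)
    obtain ⟨U, hU, hUn⟩ := exists_nhds_le_add_of_upper (f := f) (c := 0) (r := t / 2) hupper
      (half_pos ht) (y₀ := y₀) (fun y hy => by
        refine (hf.zero_off y fun hyΩ => htΩ (?_ : y ∈ Metric.ball y₀ t) (subset_closure hyΩ)).le
        rw [Metric.mem_ball, dist_comm]
        linarith) hη
    refine ⟨U, mem_nhdsWithin_of_mem_nhds hU, ?_⟩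
    filter_upwards [hUn] with n hn y hy
    linarith [hn y hy, hf.nonneg (y - δ • v)]

end ParetoSort

/-! ### Comparison of the value functions: the upper bound. -/

namespace ParetoSort

variable {d : ℕ} {Ω : Set (Pt d)} {f : Pt d → ℝ} {fn : ℕ → Pt d → ℝ}

lemma norm_le_sum_abs (x : Pt d) : ‖x‖ ≤ ∑ i, |x i| := by
  rw [EuclideanSpace.norm_eq]
  refine Real.sqrt_le_iff.2 ⟨Finset.sum_nonneg fun i _ => abs_nonneg _, ?_⟩
  exact Finset.sum_sq_le_sq_sum_of_nonneg fun i _ => norm_nonneg _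

lemma abs_apply_le_norm (x : Pt d) (i : Fin d) : |x i| ≤ ‖x‖ := PiLp.norm_apply_le x i

lemma MonoPath.dist_le {Γ P : ℝ → Pt d} (h : MonoPath Γ P) {a b : ℝ} (hab : a ≤ b) :
    dist (Γ b) (Γ a) ≤ ∑ i, Γ b i - ∑ i, Γ a i := by
  rw [dist_eq_norm, ← Finset.sum_sub_distrib]
  refine (norm_le_sum_abs _).trans (Finset.sum_le_sum fun i _ => ?_)
  rw [PiLp.sub_apply, abs_of_nonneg (sub_nonneg.2 (h.mono i hab))]

lemma MonoPath.mem_unitCube {Γ P : ℝ → Pt d} (h : MonoPath Γ P) {a b t : ℝ}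
    (ha : Γ a ∈ unitCube d) (hb : Γ b ∈ unitCube d) (ht : t ∈ Icc a b) : Γ t ∈ unitCube d :=
  fun i => ⟨(ha i).1.trans (h.mono i ht.1), (h.mono i ht.2).trans (hb i).2⟩

/-- The error is written `θ ^ d` because subadditivity of the `d`-th root turns it into `θ`. -/
lemma pathEnergy_le_translate (hd : 2 ≤ d) {g : Pt d → ℝ} (hg : IsCubeDensity g)
    (hf : IsCubeDensity f) {Γ P : ℝ → Pt d} (h : MonoPath Γ P) {a b θ : ℝ} (hab : a ≤ b)
    (hθ : 0 ≤ θ) (w : Pt d) (hle : ∀ t ∈ Icc a b, g (Γ t) ≤ f (Γ t - w) + θ ^ d) :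
    pathEnergy g Γ P a b ≤ pathEnergy f (fun t => Γ t - w) P a b +
      θ * ∫ t in a..b, weight P t := by
  obtain ⟨C, -, hC⟩ := hg.exists_isBddDensity
  obtain ⟨C', -, hC'⟩ := hf.exists_isBddDensity
  have hd1 : (1 : ℝ) ≤ d := by exact_mod_cast (by omega : 1 ≤ d)
  have hi := hC'.intervalIntegrable (h.sub_const w) a b
  have hi2 : IntervalIntegrable (fun t => θ * weight P t) volume a b :=
    (continuous_const.mul h.continuous_weight).intervalIntegrable _ _
  rw [pathEnergy, pathEnergy, ← intervalIntegral.integral_const_mul,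
    ← intervalIntegral.integral_add hi hi2]
  refine intervalIntegral.integral_mono_on hab (hC.intervalIntegrable h a b) (hi.add hi2)
    fun t ht => ?_
  rw [← add_mul]
  refine mul_le_mul_of_nonneg_right ?_ (h.weight_nonneg t)
  calc g (Γ t) ^ (1 / (d : ℝ)) ≤ (f (Γ t - w) + θ ^ d) ^ (1 / (d : ℝ)) :=
        Real.rpow_le_rpow (hg.nonneg _) (hle t ht) (by positivity)
    _ ≤ f (Γ t - w) ^ (1 / (d : ℝ)) + (θ ^ d) ^ (1 / (d : ℝ)) :=
        Real.rpow_add_le_add_rpow (hf.nonneg _) (by positivity) (by positivity)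
          (by rw [div_le_one (by linarith)]; exact hd1)
    _ = f (Γ t - w) ^ (1 / (d : ℝ)) + θ := by
        rw [one_div, Real.pow_rpow_inv_natCast hθ (by omega)]

/-- A curve that is cut into `k` short pieces gains at most the value of its end point, up to an
error for each piece. -/
lemma pathEnergy_le_valueFn_add_mul (hd : 2 ≤ d) {g : Pt d → ℝ} (hg : IsCubeDensity g)
    {Γ P : ℝ → Pt d} (h : MonoPath Γ P) {a b₀ σ κ : ℝ} (hσ : 0 ≤ σ) (hκ : 0 ≤ κ)
    (hf : IsCubeDensity f)
    (hpiece : ∀ c b, a ≤ c → c ≤ b → b ≤ b₀ → ∑ i, Γ b i - ∑ i, Γ c i ≤ σ →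
      pathEnergy g Γ P c b + valueFn f (Γ c) ≤ valueFn f (Γ b) + κ) (k : ℕ) :
    ∀ b, a ≤ b → b ≤ b₀ → ∑ i, Γ b i - ∑ i, Γ a i ≤ k * σ →
      pathEnergy g Γ P a b ≤ valueFn f (Γ b) + k * κ := by
  obtain ⟨C, hC0, hC⟩ := hg.exists_isBddDensity
  induction k with
  | zero =>
    intro b hab _ hS
    have h1 := h.integral_weight_le_sum (by omega) hab
    rw [Finset.sum_sub_distrib] at h1
    have h2 := hC.pathEnergy_le h hab
    have h3 : C ^ (1 / (d : ℝ)) * ∫ t in a..b, weight P t ≤ 0 := by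
      refine mul_nonpos_of_nonneg_of_nonpos (by positivity) ?_
      simp only [Nat.cast_zero, zero_mul] at hS
      linarith
    have h4 := valueFn_nonneg hf (Γ b)
    simp only [Nat.cast_zero, zero_mul, add_zero]
    linarith
  | succ k ih =>
    intro b hab hb hS
    push_cast at hS ⊢
    rcases le_or_gt (∑ i, Γ b i - ∑ i, Γ a i) (k * σ) with hk | hk
    · linarith [ih b hab hb hk]
    have hcont : Continuous fun t => ∑ i, Γ t i :=
      continuous_finsetSum _ fun i _ => continuous_coord h.continuous i
    -- The coordinate sum serves as length; the cut leaves exactly `k * σ` before `c` and at most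
    -- `σ` after it.
    obtain ⟨c, hc, hce⟩ := intermediate_value_Icc hab hcont.continuousOn
      (show ∑ i, Γ a i + k * σ ∈ Icc (∑ i, Γ a i) (∑ i, Γ b i) from
        ⟨le_add_of_nonneg_right (by positivity), by linarith⟩)
    simp only at hce
    have h1 := ih c hc.1 (hc.2.trans hb) (by linarith)
    have h2 := hpiece c b hc.1 hc.2 hb (by linarith)
    rw [← hC.pathEnergy_add h a c b]
    linarith

/-- The neighborhoods `W x` do not depend on the tolerance. Hence the cover and the number `k` of
pieces are fixed before the error `κ'` per piece, then `δ`, and finally `n`. -/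
lemma eventually_valueFn_le_add (hd : 2 ≤ d) (hΩ : HypH2Star Ω) (hf : HypH1 Ω f)
    (hfn : ∀ n, IsCubeDensity (fn n))
    (hlower : ∀ x, lowerEnvelope f x ≤ lowerRelaxedLimit fn x)
    (hupper : ∀ x, upperRelaxedLimit fn x ≤ upperEnvelope f x) {κ : ℝ} (hκ : 0 < κ) :
    ∀ᶠ n in atTop, ∀ x, valueFn (fn n) x ≤ valueFn f x + κ := by
  have hlsc := hf.lowerSemicontinuous hΩ.isOpen
  have hfc := hf.isCubeDensity hΩ hfn hlower
  choose v W hW hloc using exists_translate_bound (by omega) hΩ hf hupper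
  obtain ⟨T, -, hT⟩ := (isCompact_unitCube (d := d)).elim_nhds_subcover
    (fun x => interior (W x)) fun x _ => interior_mem_nhds.2 (hW x)
  obtain ⟨ρ, hρ, hleb⟩ := lebesgue_number_lemma_of_metric (isCompact_unitCube (d := d))
    (c := fun i : T => interior (W i)) (fun i => isOpen_interior)
    (fun y hy => by
      obtain ⟨x, hx, hxy⟩ := mem_iUnion₂.1 (hT hy)
      exact mem_iUnion.2 ⟨⟨x, hx⟩, hxy⟩)
  set σ := ρ / 2 with hσ
  have hσ0 : 0 < σ := half_pos hρ
  -- Inside the cube the coordinate sum grows by at most `d`.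
  obtain ⟨k, hk⟩ := exists_nat_ge (d / σ)
  rw [div_le_iff₀ hσ0] at hk
  set κ' := κ / (k + 1) with hκ'
  have hκ'0 : 0 < κ' := by positivity
  have hkκ : k * κ' ≤ κ := by
    rw [hκ', mul_div_assoc', div_le_iff₀ (by positivity)]; nlinarith
  obtain ⟨s, hs, hmod⟩ := exists_valueFn_le_add hd hfc hlsc (show 0 < κ' / 3 by positivity)
  set θ := κ' / 3 / σ with hθ
  have hθ0 : 0 < θ := by positivity
  have hδ1 : ∀ᶠ δ : ℝ in 𝓝[>] 0, ∀ x ∈ T, ‖δ • v x‖ < s := by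
    refine (Filter.eventually_all_finset T).2 fun x _ => ?_
    have : Tendsto (fun δ : ℝ => ‖δ • v x‖) (𝓝[>] 0) (𝓝 0) := by
      have h1 : Continuous fun δ : ℝ => ‖δ • v x‖ := by fun_prop
      simpa using (h1.tendsto 0).mono_left nhdsWithin_le_nhds
    exact this.eventually (gt_mem_nhds hs)
  have hδ2 : ∀ᶠ δ : ℝ in 𝓝[>] 0, ∀ x ∈ T, ∀ᶠ n in atTop, ∀ y ∈ W x,
      fn n y ≤ f (y - δ • v x) + θ ^ d :=
    (Filter.eventually_all_finset T).2 fun x _ => hloc x _ (by positivity)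
  obtain ⟨δ, hδs, hδn⟩ := (hδ1.and hδ2).exists
  filter_upwards [(Filter.eventually_all_finset T).2 hδn] with n hn x
  have hv := valueFn_nonneg hfc x
  refine valueFn_le (by positivity) fun Γ P hp hx => ?_
  rcases exists_restrict_unitCube hp zero_le_one with h0 | ⟨a, b, -, hab, hb1, ha, hb, he⟩
  · rw [h0 _ hd (hfn n)]; positivity
  rw [he _ hd (hfn n)]
  have hbx : PLe (Γ b) x := fun i => (hp.mono i hb1).trans (hx i)
  have key := pathEnergy_le_valueFn_add_mul hd (hfn n) hp (a := a) (b₀ := b) hσ0.le hκ'0.le hfc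
    -- Three errors of `κ' / 3`: translating the initial point, translating the final point, and `θ
    -- * σ` from the density.
    (fun c e hac hce heb hS => by
      obtain ⟨i, hi⟩ := hleb (Γ c) (hp.mem_unitCube ha hb ⟨hac, hce.trans heb⟩)
      have hw : ∀ j, |(δ • v i) j| ≤ s := fun j =>
        (abs_apply_le_norm _ j).trans (hδs i i.2).le
      have h1 := pathEnergy_le_translate hd (hfn n) hfc hp hce hθ0.le (δ • v i) fun t ht => by
        refine hn i i.2 _ (interior_subset (hi ?_))
        have h2 := hp.dist_le ht.1
        have h3 : ∑ i, Γ t i ≤ ∑ i, Γ e i := Finset.sum_le_sum fun i _ => hp.mono i ht.2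
        rw [Metric.mem_ball]
        linarith
      have h2 := valueFn_add_pathEnergy_le hd hfc hlsc (hp.sub_const (δ • v i)) hce
      have h3 := hmod (Γ c) (Γ c - δ • v i) fun j => by
        rw [PiLp.sub_apply]; linarith [(abs_le.1 (hw j)).2]
      have h4 := hmod (Γ e - δ • v i) (Γ e) fun j => by
        rw [PiLp.sub_apply]; linarith [(abs_le.1 (hw j)).1]
      have h5 : θ * ∫ t in c..e, weight P t ≤ κ' / 3 := by
        have h6 := hp.integral_weight_le_sum (by omega) hce
        rw [Finset.sum_sub_distrib] at h6
        calc θ * ∫ t in c..e, weight P t ≤ θ * σ :=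
              mul_le_mul_of_nonneg_left (h6.trans hS) hθ0.le
          _ = κ' / 3 := by rw [hθ]; field_simp
      linarith) k b hab le_rfl (by
      rw [← Finset.sum_sub_distrib]
      refine le_trans ?_ hk
      calc ∑ i, (Γ b i - Γ a i) ≤ ∑ _i : Fin d, (1 : ℝ) :=
            Finset.sum_le_sum fun i _ => by linarith [(hb i).2, (ha i).1]
        _ = d := by simp)
  linarith [valueFn_mono hd hfc hbx]

/-! ### Comparison of the value functions: the lower bound. -/

lemma exists_admissible_lt {g : Pt d → ℝ} {x : Pt d} {κ : ℝ} (hκ : 0 < κ)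
    (hx : κ < valueFn g x) :
    ∃ γ, Admissible γ ∧ PLe (γ 1) x ∧ valueFn g x - κ < energy g γ := by
  by_contra! hcon
  have : valueFn g x ≤ valueFn g x - κ := by
    refine Real.sSup_le ?_ (sub_nonneg.2 hx.le)
    rintro e ⟨γ, hγ, hγx, rfl⟩
    exact hcon γ hγ hγx
  linarith

lemma eventually_valueFn_le_add_of_lower (hd : 2 ≤ d) (hf : IsCubeDensity f)
    (hfn : ∀ n, IsCubeDensity (fn n))
    (hlow : ∀ x, ∀ η > 0, ∀ᶠ n in atTop, f x - η ≤ fn n x) (x : Pt d) {κ : ℝ} (hκ : 0 < κ) :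
    ∀ᶠ n in atTop, valueFn f x ≤ valueFn (fn n) x + κ := by
  rcases le_or_gt (valueFn f x) (κ / 2) with h0 | h0
  · exact Eventually.of_forall fun n => by linarith [valueFn_nonneg (hfn n) x]
  obtain ⟨γ, hγ, hγx, hlt⟩ := exists_admissible_lt (half_pos hκ) h0
  obtain ⟨Γ, P, hp, -, he⟩ := hγ.exists_monoPath
  obtain ⟨C, -, hC⟩ := hf.exists_isBddDensity
  choose C' _ hC' using fun n => (hfn n).exists_isBddDensity
  have hpow : (0 : ℝ) < 1 / d := by
    have : (0 : ℝ) < d := by exact_mod_cast (by omega : 0 < d)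
    positivity
  filter_upwards [eventually_lt_integral_mul (G := fun t => f (Γ t) ^ (1 / (d : ℝ)))
    (F := fun n t => fn n (Γ t) ^ (1 / (d : ℝ))) hp.continuous_weight hp.weight_nonneg
    (hC.measurable_comp hp) (fun t => hC.rpow_nonneg _) (fun t => hC.rpow_le _)
    (fun n => (hC' n).measurable_comp hp) (fun n t => (hC' n).rpow_nonneg _)
    (fun n t => (hC' n).rpow_le _)
    (fun t => eventually_sub_le_rpow hpow (hC.nonneg _) (fun n => (hC' n).nonneg _)
      (hlow (Γ t))) zero_le_one (half_pos hκ)] with n hn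
  have h1 : energy (fn n) γ ≤ valueFn (fn n) x :=
    le_csSup (bddAbove_energySet hd (hfn n) x) ⟨γ, hγ, hγx, rfl⟩
  rw [he] at h1 hlt
  simp only [pathEnergy] at h1 hlt
  linarith

lemma eventually_forall_valueFn_le_add_of_lower (hd : 2 ≤ d) (hf : IsCubeDensity f)
    (hlsc : LowerSemicontinuous f) (hfn : ∀ n, IsCubeDensity (fn n))
    (hlow : ∀ x, ∀ η > 0, ∀ᶠ n in atTop, f x - η ≤ fn n x) {κ : ℝ} (hκ : 0 < κ) :
    ∀ᶠ n in atTop, ∀ x, valueFn f x ≤ valueFn (fn n) x + κ := by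
  obtain ⟨s, hs, hmod⟩ := exists_valueFn_le_add hd hf hlsc (show 0 < κ / 3 by positivity)
  have hcube : ∀ᶠ n in atTop, ∀ z ∈ unitCube d, valueFn f z ≤ valueFn (fn n) z + 2 * (κ / 3) := by
    refine (isCompact_unitCube (d := d)).induction_on
      (p := fun S => ∀ᶠ n in atTop, ∀ z ∈ S, valueFn f z ≤ valueFn (fn n) z + 2 * (κ / 3))
      (by simp) (fun S T hST h => h.mono fun n hn z hz => hn z (hST hz))
      (fun S T hS hT => by
        filter_upwards [hS, hT] with n h1 h2 z hz
        exact hz.elim (h1 z) (h2 z)) fun z₀ _ => ?_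
    refine ⟨Metric.ball z₀ (s / 2),
      mem_nhdsWithin_of_mem_nhds (Metric.ball_mem_nhds _ (half_pos hs)), ?_⟩
    -- The base point `z₀ - (s / 2) • onesVec d` lies below every `z` of the ball, and `z` exceeds
    -- it by at most `s` in each coordinate. Convergence at this one point therefore controls the
    -- whole ball.
    filter_upwards [eventually_valueFn_le_add_of_lower hd hf hfn hlow
      (z₀ - (s / 2) • onesVec d) (show 0 < κ / 3 by positivity)] with n hn z hz
    have hz' : ∀ i, |z i - z₀ i| ≤ s / 2 := fun i => by
      have := abs_apply_le_norm (z - z₀) i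
      rw [← dist_eq_norm] at this
      exact this.trans (Metric.mem_ball.1 hz).le
    have hq : ∀ i, (z₀ - (s / 2) • onesVec d) i = z₀ i - s / 2 := fun i => by simp
    have h1 := hmod z (z₀ - (s / 2) • onesVec d) fun i => by
      rw [hq]; linarith [(abs_le.1 (hz' i)).2]
    have h2 := valueFn_mono hd (hfn n) (x := z₀ - (s / 2) • onesVec d) (y := z) fun i => by
      rw [hq]; linarith [(abs_le.1 (hz' i)).1]
    linarith
  -- For arbitrary `x`, a path collects its energy up to its last point `Γ b` in the cube, which
  -- lies below `x`.
  filter_upwards [hcube] with n hn x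
  have hv := valueFn_nonneg (hfn n) x
  refine valueFn_le (by positivity) fun Γ P hp hx => ?_
  rcases exists_restrict_unitCube hp zero_le_one with h0 | ⟨a, b, -, hab, hb1, -, hb, he⟩
  · rw [h0 _ hd hf]; positivity
  rw [he _ hd hf]
  have h1 := pathEnergy_le_valueFn hd hf hlsc hp hab
  have h2 := valueFn_mono hd (hfn n) (x := Γ b) (y := x) fun i => (hp.mono i hb1).trans (hx i)
  linarith [hn _ hb]

end ParetoSort

/-- Finiteness is stated as `BddAbove`, because the real `sSup` of an unbounded set is `0` by
convention. -/
theorem mainTheorem7 (d : ℕ) (hd : 2 ≤ d) (Ω : Set (ParetoSort.Pt d))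
    (f : ParetoSort.Pt d → ℝ) (fn : ℕ → ParetoSort.Pt d → ℝ)
    (hΩ : ParetoSort.HypH2Star Ω) (hf : ParetoSort.HypH1 Ω f)
    (hfn : ∀ n, ParetoSort.IsCubeDensity (fn n))
    (hlower : ∀ x, ParetoSort.lowerEnvelope f x ≤ ParetoSort.lowerRelaxedLimit fn x)
    (hupper : ∀ x, ParetoSort.upperRelaxedLimit fn x ≤ ParetoSort.upperEnvelope f x) :
    (∀ x, BddAbove (ParetoSort.energySet f x)) ∧
      (∀ n x, BddAbove (ParetoSort.energySet (fn n) x)) ∧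
      TendstoUniformly (fun n => ParetoSort.valueFn (fn n)) (ParetoSort.valueFn f) atTop := by
  have hlsc := hf.lowerSemicontinuous hΩ.isOpen
  have hfc := hf.isCubeDensity hΩ hfn hlower
  refine ⟨ParetoSort.bddAbove_energySet hd hfc,
    fun n => ParetoSort.bddAbove_energySet hd (hfn n), ?_⟩
  rw [Metric.tendstoUniformly_iff]
  intro ε hε
  filter_upwards [ParetoSort.eventually_valueFn_le_add hd hΩ hf hfn hlower hupper (half_pos hε),
    ParetoSort.eventually_forall_valueFn_le_add_of_lower hd hfc hlsc hfn
      (fun x η hη => ParetoSort.eventually_sub_le_of_lower hlsc hlower x hη) (half_pos hε)]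
    with n h1 h2 x
  rw [Real.dist_eq, abs_lt]
  constructor <;> linarith [h1 x, h2 x]
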